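/- Let $N\ge 1$ and let $\lambda_1,\dots,\lambda_N$ be distinct real numbers with $\lambda_\alpha\neq\pm1$; put $\Lambda=\mathrm{diag}(\lambda_1,\dots,\lambda_N)$. Identify $\mathbb R^{4N}$ with $\mathbb C^{2N}$ through the complex coordinates $\phi_{j\alpha}$ ($j=1,2$; $\alpha=1,\dots,N$), write $\Phi_j=(\phi_{j1},\dots,\phi_{jN})^T$ and $\langle V,W\rangle=V^*W$, and use the Poisson bracket $$\{f,g\}=\frac1{\mathrm i}\sum_{j=1}^2\sum_{\alpha=1}^N\left(\frac{\partial f}{\partial\phi_{j\alpha}}\frac{\partial g}{\partial\bar\phi_{j\alpha}}-\frac{\partial g}{\partial\phi_{j\alpha}}\frac{\partial f}{\partial\bar\phi_{j\alpha}}\right).$$ Let $L(\lambda)=\sum_{\alpha=1}^N\frac1{\lambda-\lambda_\alpha}\phi_\alpha\phi_\alpha^*$ with $\phi_\alpha=(\phi_{1\alpha},\phi_{2\alpha})^T$ (the Lax operator), and for $k\ge 0$ let $$E^{(1)}_k=\langle\Phi_1,\Lambda^k\Phi_1\rangle+\langle\Phi_2,\Lambda^k\Phi_2\rangle,\qquad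 E^{(2)}_k=\sum_{j=0}^k\begin{vmatrix}\langle\Phi_1,\Lambda^j\Phi_1\rangle&\langle\Phi_2,\Lambda^{k-j}\Phi_1\rangle\\ \langle\Phi_1,\Lambda^j\Phi_2\rangle&\langle\Phi_2,\Lambda^{k-j}\Phi_2\rangle\end{vmatrix}.$$ These are the coefficients in the expansions at infinity of the invariants of $L$: for every complex $\lambda$ with $|\lambda|>\max_\alpha|\lambda_\alpha|$, $$\operatorname{tr}L(\lambda)=\sum_{k\ge0}E^{(1)}_k\lambda^{-k-1},\qquad \det L(\lambda)=\tfrac12\left((\operatorname{tr}L(\lambda))^2-\operatorname{tr}L(\lambda)^2\right)=\sum_{k\ge0}E^{(2)}_k\lambda^{-k-2}.$$ Consider the $2N$ functions $$E^{(1)}_0,\dots,E^{(1)}_{N-1},\qquad E^{(2)}_0,\dots,E^{(2)}_{N-2},\qquad \langle\Phi_1,\Phi_2\rangle+\langle\Phi_2,\Phi_1\rangle$$ on $\mathbb R^{4N}$ (for $N=1$ there is no function $E^{(2)}_k$ among them). They are real-valued, any two of them have Poisson bracket identically zero, and they are functionally independent on a dense open subset of $\mathbb R^{4N}$; that is, their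 real differentials are linearly independent over $\mathbb R$ at each point of some dense open subset. -/

import Mathlib

namespace ChiralField

open Matrix

/-- The phase space `ℝ^{2nN}`, with complex coordinates `φ j α = φ_{jα}` and their conjugates;
`φ j` is the vector `Φ_j = (φ_{j1}, …, φ_{jN})`. It is used as a real vector space. -/
abbrev Phase (n N : ℕ) : Type := Fin n → Fin N → ℂ

noncomputable section

/-- The tangent vector that moves only the coordinate `φ_{jα}`, by the complex amount `c`. -/
def tangent {n N : ℕ} (j : Fin n) (α : Fin N) (c : ℂ) : Phase n N :=
  Pi.single j (Pi.single α c)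

/-- `∂f/∂φ_{jα} = (∂f/∂Re φ_{jα} - i ∂f/∂Im φ_{jα}) / 2`. -/
def dPhi {n N : ℕ} (f : Phase n N → ℂ) (j : Fin n) (α : Fin N) (φ : Phase n N) : ℂ :=
  (fderiv ℝ f φ (tangent j α 1) - Complex.I * fderiv ℝ f φ (tangent j α Complex.I)) / 2

/-- `∂f/∂φ̄_{jα} = (∂f/∂Re φ_{jα} + i ∂f/∂Im φ_{jα}) / 2`. -/
def dPhiBar {n N : ℕ} (f : Phase n N → ℂ) (j : Fin n) (α : Fin N) (φ : Phase n N) : ℂ :=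
  (fderiv ℝ f φ (tangent j α 1) + Complex.I * fderiv ℝ f φ (tangent j α Complex.I)) / 2

/-- The Poisson bracket of the symplectic form `i ∑ dφ̄_{jα} ∧ dφ_{jα}`. -/
def poisson {n N : ℕ} (f g : Phase n N → ℂ) (φ : Phase n N) : ℂ :=
  (1 / Complex.I) * ∑ j : Fin n, ∑ α : Fin N,
    (dPhi f j α φ * dPhiBar g j α φ - dPhi g j α φ * dPhiBar f j α φ)

/-- The Lax operator `L(z) = ∑_α (z - lam_α)⁻¹ φ_α φ_α^*`, where `φ_α = (φ_{1α}, …, φ_{nα})^T`. -/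
def lax {n N : ℕ} (lam : Fin N → ℝ) (φ : Phase n N) (z : ℂ) : Matrix (Fin n) (Fin n) ℂ :=
  ∑ α : Fin N, (z - (lam α : ℂ))⁻¹ • vecMulVec (fun i => φ i α) (star fun i => φ i α)

/-- `⟨Φ_i, Λ^r Φ_j⟩`, where `Λ = diag(lam)` and `⟨V, W⟩ = V^* W`. -/
def moment {n N : ℕ} (lam : Fin N → ℝ) (r : ℕ) (i j : Fin n) (φ : Phase n N) : ℂ :=
  ∑ α : Fin N, star (φ i α) * ((lam α : ℂ) ^ r * φ j α)

/-- `E^{(1)}_k` for `n = 2`. -/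
def energy₁ {N : ℕ} (lam : Fin N → ℝ) (k : ℕ) (φ : Phase 2 N) : ℂ :=
  moment lam k 0 0 φ + moment lam k 1 1 φ

/-- `E^{(2)}_k` for `n = 2`. -/
def energy₂ {N : ℕ} (lam : Fin N → ℝ) (k : ℕ) (φ : Phase 2 N) : ℂ :=
  ∑ j ∈ Finset.range (k + 1),
    (!![moment lam j 0 0 φ, moment lam (k - j) 1 0 φ;
        moment lam j 0 1 φ, moment lam (k - j) 1 1 φ]).det

/-- `⟨Φ₁, Φ₂⟩ + ⟨Φ₂, Φ₁⟩`. -/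
def extraIntegral {N : ℕ} (φ : Phase 2 N) : ℂ :=
  star (φ 0) ⬝ᵥ φ 1 + star (φ 1) ⬝ᵥ φ 0

/-- The `2N` functions: the index `(0, k)` gives `E^{(1)}_k` for `0 ≤ k ≤ N - 1`; the index
`(1, k)` gives `E^{(2)}_k` for `0 ≤ k ≤ N - 2` and the extra integral for `k = N - 1`. -/
def integral {N : ℕ} (lam : Fin N → ℝ) (mk : Fin 2 × Fin N) : Phase 2 N → ℂ :=
  if mk.1 = 0 then energy₁ lam mk.2
  else if (mk.2 : ℕ) + 1 < N then energy₂ lam mk.2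
  else extraIntegral

/-- Real functions are functionally independent at `x`: they are differentiable there and their
differentials at `x` are linearly independent. -/
def FunctionallyIndependentAt {ι V : Type*} [NormedAddCommGroup V] [NormedSpace ℝ V]
    (f : ι → V → ℝ) (x : V) : Prop :=
  (∀ i, DifferentiableAt ℝ (f i) x) ∧ LinearIndependent ℝ (fun i => fderiv ℝ (f i) x)

end

end ChiralField

/-!
The functions are polynomials in the moments `M_r`, the `2 × 2` matrices with entries
`⟨Φ_i, Λ^r Φ_j⟩`; up to transposition these are the coefficients of the Lax matrix at infinity,
so that the expansions of its trace and determinant are a geometric series and a Cauchy product.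

*Involution.* The moments close under the bracket and form a copy of the loop algebra `gl_2[t]`
(`poisson_moment`). Traces of moments are central, and `poisson_energy₂_moment` computes the flow
of `energy₂ lam k` as a sum of commutators `[M_q, M_{p+b}]` over `p + q = k`. For `b = 0` the sum
is antisymmetric, which deals with the extra integral. The bracket of two functions `energy₂` is
a double sum of the totally antisymmetric expression `tr ([M_a, M_b] M_c)`, and every such double
sum vanishes (`sum_antidiagonal_eq_zero_of_antisymm`).

*Independence.* A minor of the Jacobian is an analytic function, so it is enough that it does not
vanish at one point (`exists_dense_functionallyIndependentAt`). Such a point is the real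
configuration `φ_α = (p_α, q_α)` with `(p_α + i q_α)² = 1 + i λ_α`: the spin vector
`(p_α² - q_α², 2 p_α q_α)` is then `(1, λ_α)`, two spins have cross product `λ_β - λ_α`, and this
cancels the denominators `λ_α - λ_β` of the Gaudin Hamiltonians generated by `det L`. Hence the
derivative of `energy₂ lam k` along the rotation at the site `α` is
`N λ_α^(k+1) - ∑_β λ_β^(k+1)` (`fderiv_energy₂_rotation`), while that of the extra integral is
constant, and rotations do not change any `energy₁`. What is left are two Vandermonde systems
(`linearIndependent_fderiv_integral`).
-/

namespace ChiralField

open Matrix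
open Finset.HasAntidiagonal (antidiagonal)

/-! ### Moments and their derivatives -/

/-- The coordinate `φ ↦ φ_{jα}` as a real-linear map. -/
noncomputable def coord {n N : ℕ} (j : Fin n) (α : Fin N) : Phase n N →L[ℝ] ℂ :=
  (ContinuousLinearMap.proj α).comp
    (ContinuousLinearMap.proj (R := ℝ) (φ := fun _ : Fin n => Fin N → ℂ) j)

@[simp] lemma coord_apply {n N : ℕ} (j : Fin n) (α : Fin N) (φ : Phase n N) :
    coord j α φ = φ j α := rfl

lemma analyticAt_moment {n N : ℕ} (lam : Fin N → ℝ) (r : ℕ) (i j : Fin n) (φ : Phase n N) :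
    AnalyticAt ℝ (moment lam r i j) φ := by
  unfold moment
  refine Finset.analyticAt_fun_sum _ fun α _ => ?_
  exact ((((starL' ℝ : ℂ ≃L[ℝ] ℂ) : ℂ →L[ℝ] ℂ).comp (coord i α)).analyticAt φ).mul
    (analyticAt_const.mul ((coord j α).analyticAt φ))

lemma differentiableAt_moment {n N : ℕ} (lam : Fin N → ℝ) (r : ℕ) (i j : Fin n)
    (φ : Phase n N) : DifferentiableAt ℝ (moment lam r i j) φ :=
  (analyticAt_moment lam r i j φ).differentiableAt

lemma fderiv_moment {n N : ℕ} (lam : Fin N → ℝ) (r : ℕ) (i j : Fin n) (φ v : Phase n N) :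
    fderiv ℝ (moment lam r i j) φ v = ∑ α, (star (φ i α) * ((lam α : ℂ) ^ r * v j α)
      + star (v i α) * ((lam α : ℂ) ^ r * φ j α)) := by
  have h : HasFDerivAt (moment lam r i j) _ φ :=
    HasFDerivAt.fun_sum (u := Finset.univ) fun α _ =>
      ((coord i α).hasFDerivAt (x := φ)).star.mul
        (((coord j α).hasFDerivAt (x := φ)).const_mul ((lam α : ℂ) ^ r))
  rw [h.fderiv]
  simp [mul_comm]

lemma star_moment {n N : ℕ} (lam : Fin N → ℝ) (r : ℕ) (i j : Fin n) (φ : Phase n N) :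
    star (moment lam r i j φ) = moment lam r j i φ := by
  simp only [moment, star_sum, star_mul', star_star]
  refine Finset.sum_congr rfl fun α _ => ?_
  simp
  ring

lemma energy₂_eq_antidiagonal {N : ℕ} (lam : Fin N → ℝ) (k : ℕ) (φ : Phase 2 N) :
    energy₂ lam k φ = ∑ x ∈ antidiagonal k,
      (moment lam x.1 0 0 φ * moment lam x.2 1 1 φ
        - moment lam x.2 1 0 φ * moment lam x.1 0 1 φ) := by
  rw [Finset.Nat.sum_antidiagonal_eq_sum_range_succ (fun p q =>
    moment lam p 0 0 φ * moment lam q 1 1 φ - moment lam q 1 0 φ * moment lam p 0 1 φ)]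
  simp [energy₂, det_fin_two]

lemma extraIntegral_eq_moment {N : ℕ} (lam : Fin N → ℝ) (φ : Phase 2 N) :
    extraIntegral φ = moment lam 0 0 1 φ + moment lam 0 1 0 φ := by
  simp [extraIntegral, moment, dotProduct]

lemma analyticAt_energy₁ {N : ℕ} (lam : Fin N → ℝ) (k : ℕ) (φ : Phase 2 N) :
    AnalyticAt ℝ (energy₁ lam k) φ :=
  (analyticAt_moment lam k 0 0 φ).add (analyticAt_moment lam k 1 1 φ)

lemma analyticAt_energy₂ {N : ℕ} (lam : Fin N → ℝ) (k : ℕ) (φ : Phase 2 N) :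
    AnalyticAt ℝ (energy₂ lam k) φ := by
  rw [show energy₂ lam k = _ from funext (energy₂_eq_antidiagonal lam k)]
  refine Finset.analyticAt_fun_sum _ fun x _ => ?_
  exact ((analyticAt_moment lam _ _ _ φ).mul (analyticAt_moment lam _ _ _ φ)).sub
    ((analyticAt_moment lam _ _ _ φ).mul (analyticAt_moment lam _ _ _ φ))

lemma analyticAt_extraIntegral {N : ℕ} (φ : Phase 2 N) :
    AnalyticAt ℝ (extraIntegral (N := N)) φ := by
  rw [show extraIntegral (N := N) = _ from funext (extraIntegral_eq_moment 0)]
  exact (analyticAt_moment 0 0 0 1 φ).add (analyticAt_moment 0 0 1 0 φ)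

lemma analyticAt_integral {N : ℕ} (lam : Fin N → ℝ) (a : Fin 2 × Fin N) (φ : Phase 2 N) :
    AnalyticAt ℝ (integral lam a) φ := by
  unfold integral
  split_ifs
  exacts [analyticAt_energy₁ .., analyticAt_energy₂ .., analyticAt_extraIntegral _]

/-! ### Reality -/

lemma star_integral {N : ℕ} (lam : Fin N → ℝ) (a : Fin 2 × Fin N) (φ : Phase 2 N) :
    star (integral lam a φ) = integral lam a φ := by
  unfold integral
  split_ifs
  · simp [energy₁, star_moment]
  · rw [energy₂_eq_antidiagonal, star_sum]
    simp only [star_sub, star_mul', star_moment]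
    rw [Finset.sum_sub_distrib, Finset.sum_sub_distrib]
    congr 1
    rw [← Finset.Nat.sum_antidiagonal_swap]
    simp [mul_comm]
  · simp [extraIntegral_eq_moment lam, star_moment, add_comm]

/-! ### Expansion of the invariants of the Lax operator at infinity -/

lemma hasSum_moment {n N : ℕ} (lam : Fin N → ℝ) (φ : Phase n N) {z : ℂ} (hz : z ≠ 0)
    (h : ∀ α, |lam α| < ‖z‖) (i j : Fin n) :
    HasSum (fun k : ℕ => moment lam k i j φ * (z ^ (k + 1))⁻¹) (lax lam φ z j i) := by
  have hL : lax lam φ z j i = ∑ α, (z - lam α)⁻¹ * (φ j α * star (φ i α)) := by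
    simp [lax, Matrix.sum_apply, vecMulVec_apply]
  rw [hL]
  simp only [moment, Finset.sum_mul]
  refine hasSum_sum fun α _ => ?_
  have hlt : ‖(lam α : ℂ) / z‖ < 1 := by
    rw [norm_div, div_lt_one (norm_pos_iff.2 hz)]
    simpa using h α
  have hg := (hasSum_geometric_of_norm_lt_one hlt).mul_left (z⁻¹ * (φ j α * star (φ i α)))
  rw [show (z - lam α)⁻¹ * (φ j α * star (φ i α))
      = z⁻¹ * (φ j α * star (φ i α)) * (1 - lam α / z)⁻¹ by
    rw [one_sub_div hz]
    field_simp]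
  refine (congrArg (HasSum · _) (funext fun k => ?_)).mp hg
  simp only [div_pow, pow_succ]
  field_simp

lemma hasSum_energy₁ {N : ℕ} (lam : Fin N → ℝ) (φ : Phase 2 N) {z : ℂ} (hz : z ≠ 0)
    (h : ∀ α, |lam α| < ‖z‖) :
    HasSum (fun k : ℕ => energy₁ lam k φ * (z ^ (k + 1))⁻¹) (lax lam φ z).trace := by
  rw [trace_fin_two]
  simpa [energy₁, add_mul] using
    (hasSum_moment lam φ hz h 0 0).add (hasSum_moment lam φ hz h 1 1)

lemma hasSum_energy₂ {N : ℕ} (lam : Fin N → ℝ) (φ : Phase 2 N) {z : ℂ} (hz : z ≠ 0)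
    (h : ∀ α, |lam α| < ‖z‖) :
    HasSum (fun k : ℕ => energy₂ lam k φ * (z ^ (k + 2))⁻¹) (lax lam φ z).det := by
  have key (i j i' j' : Fin 2) := hasSum_sum_range_mul_of_summable_norm
    (hasSum_moment lam φ hz h i j).summable.norm (hasSum_moment lam φ hz h i' j').summable.norm
  simp only [(hasSum_moment lam φ hz h _ _).tsum_eq] at key
  rw [det_fin_two, mul_comm (lax lam φ z 0 1)]
  refine (congrArg (HasSum · _) (funext fun k => ?_)).mpr ((key 0 0 1 1).sub (key 0 1 1 0))
  rw [energy₂, ← Finset.sum_sub_distrib, Finset.sum_mul]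
  refine Finset.sum_congr rfl fun j hj => ?_
  have hk : k + 2 = (j + 1) + (k - j + 1) := by
    have := Finset.mem_range.1 hj
    omega
  rw [det_fin_two, hk, pow_add z (j + 1), mul_inv]
  simp
  ring

/-! ### The Poisson bracket as a biderivation -/

lemma poisson_comm {n N : ℕ} (f g : Phase n N → ℂ) (φ : Phase n N) :
    poisson f g φ = -poisson g f φ := by
  simp only [poisson, ← mul_neg, ← Finset.sum_neg_distrib]
  congr! 3
  ring

section Derivation

variable {n N : ℕ} {f g h : Phase n N → ℂ} {φ : Phase n N}

lemma poisson_add_left (hf : DifferentiableAt ℝ f φ) (hg : DifferentiableAt ℝ g φ) :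
    poisson (fun ψ => f ψ + g ψ) h φ = poisson f h φ + poisson g h φ := by
  simp only [poisson, dPhi, dPhiBar, ← mul_add, ← Finset.sum_add_distrib, fderiv_fun_add hf hg,
    _root_.add_apply]
  congr! 3
  ring

lemma poisson_sub_left (hf : DifferentiableAt ℝ f φ) (hg : DifferentiableAt ℝ g φ) :
    poisson (fun ψ => f ψ - g ψ) h φ = poisson f h φ - poisson g h φ := by
  simp only [poisson, dPhi, dPhiBar, ← mul_sub, ← Finset.sum_sub_distrib, fderiv_fun_sub hf hg,
    _root_.sub_apply]
  congr! 3
  ring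

lemma poisson_mul_left (hf : DifferentiableAt ℝ f φ) (hg : DifferentiableAt ℝ g φ) :
    poisson (fun ψ => f ψ * g ψ) h φ = f φ * poisson g h φ + g φ * poisson f h φ := by
  simp only [poisson, dPhi, dPhiBar, mul_left_comm _ (1 / Complex.I), ← mul_add,
    Finset.mul_sum (a := f φ), Finset.mul_sum (a := g φ), ← Finset.sum_add_distrib,
    fderiv_fun_mul hf hg, _root_.add_apply, _root_.smul_apply,
    smul_eq_mul]
  congr! 3
  ring

lemma poisson_sum_left {ι : Type*} (s : Finset ι) {F : ι → Phase n N → ℂ}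
    (hF : ∀ i ∈ s, DifferentiableAt ℝ (F i) φ) :
    poisson (fun ψ => ∑ i ∈ s, F i ψ) h φ = ∑ i ∈ s, poisson (F i) h φ := by
  classical
  induction s using Finset.induction_on with
  | empty => simp [poisson, dPhi, dPhiBar]
  | insert a s ha ih =>
    have hs : ∀ i ∈ s, DifferentiableAt ℝ (F i) φ :=
      fun i hi => hF i (Finset.mem_insert_of_mem hi)
    simp only [Finset.sum_insert ha, ← ih hs]
    exact poisson_add_left (hF a (Finset.mem_insert_self a s)) (DifferentiableAt.fun_sum hs)

end Derivation

/-! ### Brackets of moments -/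

lemma dPhi_moment {n N : ℕ} (lam : Fin N → ℝ) (r : ℕ) (i j k : Fin n) (α : Fin N)
    (φ : Phase n N) :
    dPhi (moment lam r i j) k α φ = if j = k then (lam α : ℂ) ^ r * star (φ i α) else 0 := by
  simp only [dPhi, fderiv_moment, tangent, Finset.mul_sum, ← Finset.sum_sub_distrib]
  rw [Finset.sum_eq_single α]
  · by_cases hj : j = k <;> by_cases hi : i = k <;>
      simp [hj, hi] <;> ring_nf <;> simp <;> ring
  · intro β _ hβ
    by_cases hj : j = k <;> by_cases hi : i = k <;> simp [hj, hi, hβ]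
  · simp

lemma dPhiBar_moment {n N : ℕ} (lam : Fin N → ℝ) (r : ℕ) (i j k : Fin n) (α : Fin N)
    (φ : Phase n N) :
    dPhiBar (moment lam r i j) k α φ = if i = k then (lam α : ℂ) ^ r * φ j α else 0 := by
  simp only [dPhiBar, fderiv_moment, tangent, Finset.mul_sum, ← Finset.sum_add_distrib]
  rw [Finset.sum_eq_single α]
  · by_cases hj : j = k <;> by_cases hi : i = k <;>
      simp [hj, hi] <;> ring_nf <;> simp <;> ring
  · intro β _ hβ
    by_cases hj : j = k <;> by_cases hi : i = k <;> simp [hj, hi, hβ]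
  · simp

/-- The moments span the loop algebra `gl_n[t]`, `moment lam a i j` being the coordinate dual to
an elementary matrix times `t ^ a`. -/
lemma poisson_moment {n N : ℕ} (lam : Fin N → ℝ) (a b : ℕ) (i j k l : Fin n) (φ : Phase n N) :
    poisson (moment lam a i j) (moment lam b k l) φ =
      Complex.I * ((if l = i then moment lam (a + b) k j φ else 0)
        - (if j = k then moment lam (a + b) i l φ else 0)) := by
  simp only [poisson, dPhi_moment, dPhiBar_moment]
  rw [Finset.sum_comm]
  simp only [ite_mul, mul_ite, zero_mul, mul_zero, Finset.sum_sub_distrib, Finset.sum_ite_eq,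
    Finset.mem_univ, if_true, one_div, Complex.inv_I, moment]
  have e1 : (∑ α, ∑ x, if k = x then if j = x then
      (lam α : ℂ) ^ a * star (φ i α) * ((lam α : ℂ) ^ b * φ l α) else 0 else 0)
      = if j = k then ∑ α, star (φ i α) * ((lam α : ℂ) ^ (a + b) * φ l α) else 0 := by
    simp only [Finset.sum_ite_eq, Finset.mem_univ, if_true]
    split_ifs
    · refine Finset.sum_congr rfl fun α _ => ?_
      ring
    · simp
  have e2 : (∑ α, ∑ x, if i = x then if l = x then
      (lam α : ℂ) ^ b * star (φ k α) * ((lam α : ℂ) ^ a * φ j α) else 0 else 0)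
      = if l = i then ∑ α, star (φ k α) * ((lam α : ℂ) ^ (a + b) * φ j α) else 0 := by
    simp only [Finset.sum_ite_eq, Finset.mem_univ, if_true]
    split_ifs
    · refine Finset.sum_congr rfl fun α _ => ?_
      ring
    · simp
  simp only [Finset.sum_ite_eq, Finset.mem_univ, if_true] at e1 e2
  rw [e1, e2]
  ring

lemma poisson_energy₁_moment {N : ℕ} (lam : Fin N → ℝ) (a b : ℕ) (i j : Fin 2)
    (φ : Phase 2 N) : poisson (energy₁ lam a) (moment lam b i j) φ = 0 := by
  change poisson (fun ψ => moment lam a 0 0 ψ + moment lam a 1 1 ψ) _ φ = 0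
  rw [poisson_add_left (differentiableAt_moment ..) (differentiableAt_moment ..),
    poisson_moment, poisson_moment]
  fin_cases i <;> fin_cases j <;> simp

/-- Swapping the summation indices in half of the terms puts the first index on every moment
that is differentiated. -/
lemma poisson_energy₂_left {N : ℕ} (lam : Fin N → ℝ) (k : ℕ) (h : Phase 2 N → ℂ)
    (φ : Phase 2 N) :
    poisson (energy₂ lam k) h φ = ∑ x ∈ antidiagonal k,
      (moment lam x.2 1 1 φ * poisson (moment lam x.1 0 0) h φ
        + moment lam x.2 0 0 φ * poisson (moment lam x.1 1 1) h φ
        - moment lam x.2 1 0 φ * poisson (moment lam x.1 0 1) h φ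
        - moment lam x.2 0 1 φ * poisson (moment lam x.1 1 0) h φ) := by
  rw [show energy₂ lam k = _ from funext (energy₂_eq_antidiagonal lam k), poisson_sum_left]
  · have d (r i j) := differentiableAt_moment lam r i j φ
    have e (x : ℕ × ℕ) : poisson (fun ψ => moment lam x.1 0 0 ψ * moment lam x.2 1 1 ψ
        - moment lam x.2 1 0 ψ * moment lam x.1 0 1 ψ) h φ
        = (moment lam x.1 0 0 φ * poisson (moment lam x.2 1 1) h φ
            + moment lam x.2 1 1 φ * poisson (moment lam x.1 0 0) h φ)
          - (moment lam x.2 1 0 φ * poisson (moment lam x.1 0 1) h φ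
            + moment lam x.1 0 1 φ * poisson (moment lam x.2 1 0) h φ) := by
      rw [poisson_sub_left ((d ..).fun_mul (d ..)) ((d ..).fun_mul (d ..)),
        poisson_mul_left (d ..) (d ..), poisson_mul_left (d ..) (d ..)]
    simp only [e, Finset.sum_sub_distrib, Finset.sum_add_distrib]
    rw [← Finset.Nat.sum_antidiagonal_swap (n := k) (f := fun x =>
        moment lam x.2 0 0 φ * poisson (moment lam x.1 1 1) h φ),
      ← Finset.Nat.sum_antidiagonal_swap (n := k) (f := fun x =>
        moment lam x.2 0 1 φ * poisson (moment lam x.1 1 0) h φ)]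
    simp only [Prod.fst_swap, Prod.snd_swap]
    ring
  · intro x _
    have d (r i j) := differentiableAt_moment lam r i j φ
    exact ((d ..).fun_mul (d ..)).fun_sub ((d ..).fun_mul (d ..))

/-- The matrix `M_r` with entries `⟨Φ_i, Λ^r Φ_j⟩`. -/
noncomputable def momentMatrix {n N : ℕ} (lam : Fin N → ℝ) (φ : Phase n N) (r : ℕ) :
    Matrix (Fin n) (Fin n) ℂ :=
  Matrix.of fun i j => moment lam r i j φ

lemma poisson_energy₂_moment {N : ℕ} (lam : Fin N → ℝ) (k b : ℕ) (i j : Fin 2)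
    (φ : Phase 2 N) :
    poisson (energy₂ lam k) (moment lam b i j) φ = Complex.I * ∑ x ∈ antidiagonal k,
      ⁅momentMatrix lam φ x.2, momentMatrix lam φ (x.1 + b)⁆ i j := by
  rw [poisson_energy₂_left, Finset.mul_sum]
  refine Finset.sum_congr rfl fun x _ => ?_
  simp only [poisson_moment, momentMatrix, Ring.lie_def, Matrix.sub_apply, Matrix.mul_apply,
    Fin.sum_univ_two, Matrix.of_apply]
  fin_cases i <;> fin_cases j <;> simp <;> ring

/-! ### Involution -/

/-- Both antisymmetries together make the left-hand side depend on `k + l` only; for `k = 0` it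
vanishes. -/
lemma sum_antidiagonal_eq_zero_of_antisymm (T : ℕ → ℕ → ℕ → ℂ)
    (h₁ : ∀ a b c, T a b c = -T b a c) (h₂ : ∀ a b c, T a b c = -T a c b) (k l : ℕ) :
    ∑ x ∈ antidiagonal k, ∑ y ∈ antidiagonal l, T x.1 (x.2 + y.2) y.1 = 0 := by
  have zero (n : ℕ) (f : ℕ → ℕ → ℂ) (hf : ∀ a b, f a b = -f b a) :
      ∑ x ∈ antidiagonal n, f x.1 x.2 = 0 := by
    have := Finset.Nat.sum_antidiagonal_swap (n := n) (f := fun x => f x.1 x.2)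
    simp only [Prod.fst_swap, Prod.snd_swap] at this
    rw [Finset.sum_congr rfl fun x _ => hf x.2 x.1, Finset.sum_neg_distrib] at this
    exact self_eq_neg.1 this.symm
  induction k generalizing l with
  | zero => simpa using zero l (fun s q => T 0 q s) fun a b => h₂ ..
  | succ k ih =>
    have hl := ih (l + 1)
    rw [Finset.sum_congr rfl fun x _ => Finset.Nat.sum_antidiagonal_succ',
      Finset.sum_add_distrib] at hl
    rw [Finset.Nat.sum_antidiagonal_succ']
    -- The boundary terms of the two sums vanish, and the rest of them coincide.
    have e₁ := zero k (fun p q => T p q (l + 1)) fun a b => h₁ ..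
    have e₂ := zero l (fun s q => T (k + 1) q s) fun a b => h₂ ..
    simp only [add_zero] at hl
    rw [e₁, zero_add] at hl
    simp only [zero_add]
    rw [e₂, zero_add, ← hl]
    simp only [add_assoc, add_comm 1]

lemma trace_lie_mul_antisymm₁ {n : ℕ} (A B C : Matrix (Fin n) (Fin n) ℂ) :
    (⁅A, B⁆ * C).trace = -(⁅B, A⁆ * C).trace := by
  rw [← trace_neg, ← neg_mul, Ring.lie_def, Ring.lie_def, neg_sub]

lemma trace_lie_mul_antisymm₂ {n : ℕ} (A B C : Matrix (Fin n) (Fin n) ℂ) :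
    (⁅A, B⁆ * C).trace = -(⁅A, C⁆ * B).trace := by
  simp only [Ring.lie_def, sub_mul, trace_sub]
  rw [trace_mul_cycle A B C, trace_mul_cycle A C B]
  ring

lemma poisson_energy₂_energy₂ {N : ℕ} (lam : Fin N → ℝ) (k l : ℕ) (φ : Phase 2 N) :
    poisson (energy₂ lam k) (energy₂ lam l) φ = 0 := by
  set M := momentMatrix lam φ with hM
  have key := sum_antidiagonal_eq_zero_of_antisymm (fun a b c => (⁅M a, M b⁆ * M c).trace)
    (fun _ _ _ => trace_lie_mul_antisymm₁ ..) (fun _ _ _ => trace_lie_mul_antisymm₂ ..) l k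
  have key' : ∑ x ∈ antidiagonal k, ∑ y ∈ antidiagonal l,
      (⁅M y.2, M (y.1 + x.1)⁆ * M x.2).trace = 0 := by
    rw [Finset.sum_comm, ← key, ← Finset.Nat.sum_antidiagonal_swap (n := l)]
    refine Finset.sum_congr rfl fun y _ => ?_
    rw [← Finset.Nat.sum_antidiagonal_swap]
    rfl
  rw [poisson_energy₂_left, ← mul_zero Complex.I, ← key', Finset.mul_sum]
  refine Finset.sum_congr rfl fun x _ => ?_
  simp only [poisson_comm _ (energy₂ lam l), poisson_energy₂_moment, Finset.mul_sum, ← hM,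
    ← Finset.sum_add_distrib, ← Finset.sum_sub_distrib, ← Finset.sum_neg_distrib]
  refine Finset.sum_congr rfl fun y _ => ?_
  -- A commutator has trace zero, so the adjugate of `M x.2` may be replaced by `-M x.2`.
  have hC : ⁅M y.2, M (y.1 + x.1)⁆ 1 1 = -⁅M y.2, M (y.1 + x.1)⁆ 0 0 := by
    have : ⁅M y.2, M (y.1 + x.1)⁆.trace = 0 := by
      rw [Ring.lie_def, trace_sub, trace_mul_comm, sub_self]
    rw [trace_fin_two] at this
    linear_combination this
  have hx (i j : Fin 2) : moment lam x.2 i j φ = M x.2 i j := rfl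
  simp only [trace_fin_two, Matrix.mul_apply, Fin.sum_univ_two, hC, hx]
  ring

lemma poisson_extraIntegral_left {N : ℕ} (lam : Fin N → ℝ) (h : Phase 2 N → ℂ)
    (φ : Phase 2 N) : poisson extraIntegral h φ =
      poisson (moment lam 0 0 1) h φ + poisson (moment lam 0 1 0) h φ := by
  rw [show extraIntegral (N := N) = _ from funext (extraIntegral_eq_moment lam),
    poisson_add_left (differentiableAt_moment ..) (differentiableAt_moment ..)]

/-- The total spin `M_0` generates the global unitary rotations, which preserve the invariants
of the Lax matrix. -/
lemma poisson_energy₂_moment_zero {N : ℕ} (lam : Fin N → ℝ) (k : ℕ) (i j : Fin 2)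
    (φ : Phase 2 N) : poisson (energy₂ lam k) (moment lam 0 i j) φ = 0 := by
  rw [poisson_energy₂_moment]
  set S := ∑ x ∈ antidiagonal k, ⁅momentMatrix lam φ x.2, momentMatrix lam φ (x.1 + 0)⁆ i j
    with hS
  have : S = -S := by
    conv_lhs => rw [hS, ← Finset.Nat.sum_antidiagonal_swap]
    rw [hS, ← Finset.sum_neg_distrib]
    refine Finset.sum_congr rfl fun x _ => ?_
    simp [Ring.lie_def]
  rw [self_eq_neg.1 this, mul_zero]

lemma poisson_energy₁_energy₂ {N : ℕ} (lam : Fin N → ℝ) (k l : ℕ) (φ : Phase 2 N) :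
    poisson (energy₁ lam k) (energy₂ lam l) φ = 0 := by
  rw [poisson_comm, poisson_energy₂_left]
  simp [poisson_comm _ (energy₁ lam k), poisson_energy₁_moment]

lemma poisson_energy₁_energy₁ {N : ℕ} (lam : Fin N → ℝ) (k l : ℕ) (φ : Phase 2 N) :
    poisson (energy₁ lam k) (energy₁ lam l) φ = 0 := by
  change poisson (fun ψ => moment lam k 0 0 ψ + moment lam k 1 1 ψ) _ φ = 0
  rw [poisson_add_left (differentiableAt_moment ..) (differentiableAt_moment ..)]
  simp [poisson_comm _ (energy₁ lam l), poisson_energy₁_moment]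

lemma poisson_energy₁_extraIntegral {N : ℕ} (lam : Fin N → ℝ) (k : ℕ) (φ : Phase 2 N) :
    poisson (energy₁ lam k) extraIntegral φ = 0 := by
  rw [poisson_comm, poisson_extraIntegral_left lam]
  simp [poisson_comm _ (energy₁ lam k), poisson_energy₁_moment]

lemma poisson_energy₂_extraIntegral {N : ℕ} (lam : Fin N → ℝ) (k : ℕ) (φ : Phase 2 N) :
    poisson (energy₂ lam k) extraIntegral φ = 0 := by
  rw [poisson_comm, poisson_extraIntegral_left lam]
  simp [poisson_comm _ (energy₂ lam k), poisson_energy₂_moment_zero]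

lemma poisson_integral {N : ℕ} (lam : Fin N → ℝ) (a b : Fin 2 × Fin N) (φ : Phase 2 N) :
    poisson (integral lam a) (integral lam b) φ = 0 := by
  have self : poisson extraIntegral extraIntegral φ = 0 :=
    self_eq_neg.1 (poisson_comm extraIntegral extraIntegral φ)
  unfold integral
  split_ifs
  · exact poisson_energy₁_energy₁ ..
  · exact poisson_energy₁_energy₂ ..
  · exact poisson_energy₁_extraIntegral ..
  · rw [poisson_comm, poisson_energy₁_energy₂, neg_zero]
  · exact poisson_energy₂_energy₂ ..
  · exact poisson_energy₂_extraIntegral ..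
  · rw [poisson_comm, poisson_energy₁_extraIntegral, neg_zero]
  · rw [poisson_comm, poisson_energy₂_extraIntegral, neg_zero]
  · exact self

/-! ### Functional independence from one nonvanishing minor -/

/-- Real-analytic functions, as many as the chosen directions, are independent on a dense open
set as soon as their directional derivatives along these directions form an invertible matrix at
one point: the determinant is analytic, so its zero set has no interior. -/
lemma exists_dense_functionallyIndependentAt {ι V : Type*} [Fintype ι] [DecidableEq ι]
    [NormedAddCommGroup V] [NormedSpace ℝ V] (f : ι → V → ℝ)
    (hf : ∀ i x, AnalyticAt ℝ (f i) x) (x₀ : V) (v : ι → V)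
    (h₀ : LinearIndependent ℝ (Matrix.of fun i j => fderiv ℝ (f i) x₀ (v j)).row) :
    ∃ U : Set V, IsOpen U ∧ Dense U ∧ ∀ x ∈ U, FunctionallyIndependentAt f x := by
  set g : V → ℝ := fun x => (Matrix.of fun i j => fderiv ℝ (f i) x (v j)).det with hg
  have hga : AnalyticOnNhd ℝ g Set.univ := by
    intro x _
    simp only [hg, det_apply', Matrix.of_apply]
    refine Finset.analyticAt_fun_sum _ fun σ _ => analyticAt_const.mul ?_
    refine Finset.analyticAt_fun_prod _ fun j _ => ?_
    exact ((ContinuousLinearMap.apply ℝ ℝ (v j)).analyticAt _).comp (hf _ x).fderiv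
  have hg₀ : g x₀ ≠ 0 := by
    have := (linearIndependent_rows_iff_isUnit.1 h₀)
    exact ((isUnit_iff_isUnit_det _).1 this).ne_zero
  refine ⟨{x | g x ≠ 0}, ?_, ?_, fun x hx => ⟨fun i => (hf i x).differentiableAt, ?_⟩⟩
  · exact isOpen_ne_fun (continuousOn_univ.1 hga.continuousOn) continuous_const
  · intro x
    rw [mem_closure_iff_frequently]
    intro h
    have hx : g =ᶠ[nhds x] 0 := h.mono fun y hy => not_not.1 hy
    exact hg₀ (hga.eqOn_zero_of_preconnected_of_eventuallyEq_zero isPreconnected_univ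
      (Set.mem_univ x) hx (Set.mem_univ x₀))
  · have hu : LinearIndependent ℝ (Matrix.of fun i j => fderiv ℝ (f i) x (v j)).row :=
      linearIndependent_rows_iff_isUnit.2 ((isUnit_iff_isUnit_det _).2 (isUnit_iff_ne_zero.2 hx))
    let e : (V →L[ℝ] ℝ) →ₗ[ℝ] ι → ℝ :=
      LinearMap.pi fun j => (ContinuousLinearMap.apply ℝ ℝ (v j)).toLinearMap
    exact LinearIndependent.of_comp e hu

/-! ### A point of independence -/

/-- The tangent vector that moves the pair `(φ_{1α}, φ_{2α})` at the single site `α` by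
`(u, w)`. -/
def siteVector {N : ℕ} (α : Fin N) (u w : ℂ) : Phase 2 N :=
  ![Pi.single α u, Pi.single α w]

lemma fderiv_moment_siteVector {N : ℕ} (lam : Fin N → ℝ) (r : ℕ) (i j : Fin 2)
    (φ : Phase 2 N) (α : Fin N) (u w : ℂ) :
    fderiv ℝ (moment lam r i j) φ (siteVector α u w) =
      (lam α : ℂ) ^ r * (star (φ i α) * ![u, w] j + star (![u, w] i) * φ j α) := by
  rw [fderiv_moment, Finset.sum_eq_single α]
  · fin_cases i <;> fin_cases j <;> simp [siteVector] <;> ring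
  · intro β _ hβ
    fin_cases i <;> fin_cases j <;> simp [siteVector, hβ]
  · simp

/-- Real and imaginary part of a complex square root of `1 + i x`. -/
lemma exists_sq_sub_sq_eq_one (x : ℝ) : ∃ p q : ℝ, p ^ 2 - q ^ 2 = 1 ∧ 2 * p * q = x := by
  obtain ⟨z, hz⟩ := IsAlgClosed.exists_pow_nat_eq (1 + x * Complex.I) two_pos
  refine ⟨z.re, z.im, ?_, ?_⟩
  · simpa [pow_two] using congrArg Complex.re hz
  · have := congrArg Complex.im hz
    simp [pow_two] at this
    linarith

section Point

variable {N : ℕ} {lam p q : Fin N → ℝ}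

/-- A configuration all of whose coordinates are real. -/
def realPoint (p q : Fin N → ℝ) : Phase 2 N := ![fun α => (p α : ℂ), fun α => (q α : ℂ)]

lemma fderiv_energy₁ (lam : Fin N → ℝ) (k : ℕ) (φ v : Phase 2 N) :
    fderiv ℝ (energy₁ lam k) φ v =
      fderiv ℝ (moment lam k 0 0) φ v + fderiv ℝ (moment lam k 1 1) φ v := by
  change fderiv ℝ (fun ψ => moment lam k 0 0 ψ + moment lam k 1 1 ψ) φ v = _
  rw [fderiv_fun_add (differentiableAt_moment ..) (differentiableAt_moment ..)]
  rfl

lemma fderiv_extraIntegral (lam : Fin N → ℝ) (φ v : Phase 2 N) :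
    fderiv ℝ extraIntegral φ v =
      fderiv ℝ (moment lam 0 0 1) φ v + fderiv ℝ (moment lam 0 1 0) φ v := by
  rw [show extraIntegral (N := N) = _ from funext (extraIntegral_eq_moment lam),
    fderiv_fun_add (differentiableAt_moment ..) (differentiableAt_moment ..)]
  rfl

lemma fderiv_energy₂ (lam : Fin N → ℝ) (k : ℕ) (φ v : Phase 2 N) :
    fderiv ℝ (energy₂ lam k) φ v = ∑ x ∈ antidiagonal k,
      (moment lam x.2 1 1 φ * fderiv ℝ (moment lam x.1 0 0) φ v
        + moment lam x.2 0 0 φ * fderiv ℝ (moment lam x.1 1 1) φ v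
        - moment lam x.2 1 0 φ * fderiv ℝ (moment lam x.1 0 1) φ v
        - moment lam x.2 0 1 φ * fderiv ℝ (moment lam x.1 1 0) φ v) := by
  have h (r i j) := (differentiableAt_moment lam r i j φ).hasFDerivAt
  have H := HasFDerivAt.fun_sum (u := antidiagonal k) fun x _ =>
    ((h x.1 0 0).fun_mul (h x.2 1 1)).fun_sub ((h x.2 1 0).fun_mul (h x.1 0 1))
  rw [show energy₂ lam k = _ from funext (energy₂_eq_antidiagonal lam k), H.fderiv]
  simp only [_root_.sum_apply, _root_.add_apply, _root_.sub_apply, _root_.smul_apply, smul_eq_mul,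
    Finset.sum_sub_distrib, Finset.sum_add_distrib]
  rw [← Finset.Nat.sum_antidiagonal_swap (n := k) (f := fun x =>
        moment lam x.2 0 0 φ * fderiv ℝ (moment lam x.1 1 1) φ v),
      ← Finset.Nat.sum_antidiagonal_swap (n := k) (f := fun x =>
        moment lam x.2 0 1 φ * fderiv ℝ (moment lam x.1 1 0) φ v)]
  simp only [Prod.fst_swap, Prod.snd_swap]
  ring

/-- The infinitesimal rotation at the site `α` of a real configuration with `p² - q² = 1` and
`2pq = lam`: the resulting sum over `antidiagonal k` telescopes. -/
lemma fderiv_energy₂_rotation (h₁ : ∀ α, p α ^ 2 - q α ^ 2 = 1)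
    (h₂ : ∀ α, 2 * p α * q α = lam α) (k : ℕ) (α : Fin N) :
    fderiv ℝ (energy₂ lam k) (realPoint p q) (siteVector α (-q α) (p α)) =
      ((N * lam α ^ (k + 1) - ∑ β, lam β ^ (k + 1) : ℝ) : ℂ) := by
  have h₁' (α) : (p α : ℂ) ^ 2 - (q α : ℂ) ^ 2 = 1 := by exact_mod_cast h₁ α
  have h₂' (α) : 2 * (p α : ℂ) * (q α : ℂ) = lam α := by exact_mod_cast h₂ α
  set P : ℕ → ℂ := fun r => ∑ β, (lam β : ℂ) ^ r with hP
  have m₁ (r) : moment lam r 0 0 (realPoint p q) - moment lam r 1 1 (realPoint p q) = P r := by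
    simp only [moment, ← Finset.sum_sub_distrib, hP]
    refine Finset.sum_congr rfl fun β _ => ?_
    simp [realPoint]
    linear_combination (lam β : ℂ) ^ r * h₁' β
  have m₂ (r) : moment lam r 0 1 (realPoint p q) + moment lam r 1 0 (realPoint p q)
      = P (r + 1) := by
    simp only [moment, ← Finset.sum_add_distrib, hP]
    refine Finset.sum_congr rfl fun β _ => ?_
    simp [realPoint]
    linear_combination (lam β : ℂ) ^ r * h₂' β
  have tele (l : ℂ) (k : ℕ) : ∑ x ∈ antidiagonal k, (l ^ (x.1 + 1) * P x.2 - l ^ x.1 * P (x.2 + 1))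
      = l ^ (k + 1) * P 0 - P (k + 1) := by
    rw [Finset.sum_sub_distrib]
    have e₁ := Finset.Nat.sum_antidiagonal_succ (n := k) (f := fun x => l ^ x.1 * P x.2)
    have e₂ := Finset.Nat.sum_antidiagonal_succ' (n := k) (f := fun x => l ^ x.1 * P x.2)
    simp only [pow_zero, one_mul] at e₁ e₂
    linear_combination e₂ - e₁
  rw [fderiv_energy₂]
  have hN : P 0 = N := by simp [hP]
  push_cast
  rw [show ∑ β, (lam β : ℂ) ^ (k + 1) = P (k + 1) from rfl, ← hN, mul_comm, ← tele]
  refine Finset.sum_congr rfl fun x _ => ?_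
  rw [← m₁, ← m₂]
  simp only [fderiv_moment_siteVector]
  have r₀ : realPoint p q 0 α = p α := rfl
  have r₁ : realPoint p q 1 α = q α := rfl
  simp [r₀, r₁]
  linear_combination (-(lam α : ℂ) ^ x.1 * (moment lam x.2 1 0 (realPoint p q) +
    moment lam x.2 0 1 (realPoint p q))) * h₁' α + (lam α : ℂ) ^ x.1 *
    (moment lam x.2 0 0 (realPoint p q) - moment lam x.2 1 1 (realPoint p q)) * h₂' α

lemma fderiv_energy₁_rotation (k : ℕ) (α : Fin N) :
    fderiv ℝ (energy₁ lam k) (realPoint p q) (siteVector α (-q α) (p α)) = 0 := by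
  rw [fderiv_energy₁, fderiv_moment_siteVector, fderiv_moment_siteVector]
  simp [realPoint]
  ring

lemma fderiv_energy₁_radial (k : ℕ) (α : Fin N) :
    fderiv ℝ (energy₁ lam k) (realPoint p q) (siteVector α (p α) (q α)) =
      ((lam α ^ k * (2 * (p α ^ 2 + q α ^ 2)) : ℝ) : ℂ) := by
  rw [fderiv_energy₁, fderiv_moment_siteVector, fderiv_moment_siteVector]
  simp [realPoint]
  ring

lemma fderiv_extraIntegral_rotation (h₁ : ∀ α, p α ^ 2 - q α ^ 2 = 1) (α : Fin N) :
    fderiv ℝ extraIntegral (realPoint p q) (siteVector α (-q α) (p α)) = ((2 : ℝ) : ℂ) := by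
  have h₁' : (p α : ℂ) ^ 2 - (q α : ℂ) ^ 2 = 1 := by exact_mod_cast h₁ α
  rw [fderiv_extraIntegral 0, fderiv_moment_siteVector, fderiv_moment_siteVector]
  simp [realPoint]
  linear_combination 2 * h₁'

end Point

lemma fderiv_re_integral {N : ℕ} (lam : Fin N → ℝ) (a : Fin 2 × Fin N) (φ v : Phase 2 N) :
    fderiv ℝ (fun ψ => (integral lam a ψ).re) φ v = (fderiv ℝ (integral lam a) φ v).re := by
  have h := Complex.reCLM.hasFDerivAt.comp φ
    (analyticAt_integral lam a φ).differentiableAt.hasFDerivAt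
  exact congrArg (fun T : Phase 2 N →L[ℝ] ℝ => T v) h.fderiv

/-- Rotations kill every `energy₁`, so a linear relation between the differentials splits in two.
Along the rotations it says that a polynomial of degree less than `N` vanishes at the `N` points
`lam α`; along the radial directions it is then a Vandermonde system. -/
lemma linearIndependent_fderiv_integral {n : ℕ} {lam : Fin (n + 1) → ℝ}
    (hlam : Function.Injective lam) {p q : Fin (n + 1) → ℝ}
    (h₁ : ∀ α, p α ^ 2 - q α ^ 2 = 1) (h₂ : ∀ α, 2 * p α * q α = lam α) :
    LinearIndependent ℝ (Matrix.of fun a b : Fin 2 × Fin (n + 1) =>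
      fderiv ℝ (fun ψ => (integral lam a ψ).re) (realPoint p q)
        (if b.1 = 0 then siteVector b.2 (p b.2) (q b.2)
          else siteVector b.2 (-q b.2) (p b.2))).row := by
  obtain ⟨P, hP⟩ : ∃ P : ℕ → ℝ, ∀ k α,
      fderiv ℝ (energy₂ lam k) (realPoint p q) (siteVector α (-q α) (p α)) =
        (((n + 1 : ℕ) * lam α ^ (k + 1) - P k : ℝ) : ℂ) :=
    ⟨_, fderiv_energy₂_rotation h₁ h₂⟩
  rw [Fintype.linearIndependent_iff]
  intro c hc
  have entry (b : Fin 2 × Fin (n + 1)) := congrFun hc b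
  simp only [Finset.sum_apply, Pi.smul_apply, Matrix.row, Matrix.of_apply, smul_eq_mul,
    fderiv_re_integral, Fintype.sum_prod_type, Fin.sum_univ_two, Pi.zero_apply] at entry
  have rot (α : Fin (n + 1)) := entry (1, α)
  have rad (α : Fin (n + 1)) := entry (0, α)
  simp only [integral, if_true, one_ne_zero, if_false, fderiv_energy₁_rotation, Complex.zero_re,
    mul_zero, Finset.sum_const_zero, zero_add, Fin.sum_univ_castSucc, Fin.val_castSucc,
    Fin.val_last, add_lt_add_iff_right, Fin.is_lt, lt_irrefl, hP,
    fderiv_extraIntegral_rotation h₁, Complex.ofReal_re] at rot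
  have hd := eq_zero_of_forall_index_sum_mul_pow_eq_zero hlam
    -- The coefficients of the polynomial whose value at `lam α` is the left-hand side of `rot α`.
    (v := Fin.cons (c (1, Fin.last n) * 2
      - ∑ k : Fin n, c (1, k.castSucc) * P k)
      fun k : Fin n => c (1, k.castSucc) * ((n + 1 : ℕ) : ℝ)) (fun α => by
    rw [← rot α]
    simp only [Fin.sum_univ_succ, Fin.cons_zero, Fin.cons_succ, Fin.val_zero, Fin.val_succ,
      pow_zero, mul_one, mul_sub, Finset.sum_sub_distrib, mul_assoc]
    ring)
  have hN : ((n + 1 : ℕ) : ℝ) ≠ 0 := by positivity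
  have c₁ (k : Fin n) : c (1, k.castSucc) = 0 := by
    have := congrFun hd k.succ
    simpa [hN, Nat.cast_add_one_ne_zero] using this
  have c₂ : c (1, Fin.last n) = 0 := by
    have := congrFun hd 0
    simpa [c₁] using this
  have c₃ (k : Fin (n + 1)) : c (1, k) = 0 := Fin.lastCases c₂ c₁ k
  have c₄ := eq_zero_of_forall_index_sum_mul_pow_eq_zero hlam (v := fun k => c (0, k)) (fun α => by
    have h := rad α
    simp only [integral, if_true, c₃, zero_mul, Finset.sum_const_zero, add_zero,
      fderiv_energy₁_radial, Complex.ofReal_re, ← mul_assoc, ← Finset.sum_mul] at h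
    have hpos : 0 < p α ^ 2 + q α ^ 2 := by nlinarith [h₁ α, sq_nonneg (q α)]
    simpa [hpos.ne'] using h)
  rintro ⟨m, k⟩
  fin_cases m
  · exact congrFun c₄ k
  · exact c₃ k

end ChiralField

theorem mainTheorem1 (N : ℕ) (hN : 1 ≤ N) (lam : Fin N → ℝ)
    (hlam : Function.Injective lam)
    (hlam' : ∀ α, lam α ≠ 1 ∧ lam α ≠ -1) :
    -- `energy₁`, `energy₂` are the coefficients at infinity of the invariants of the Lax operator
    (∀ (φ : ChiralField.Phase 2 N) (z : ℂ), (∀ α, |lam α| < ‖z‖) →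
      HasSum (fun k : ℕ => ChiralField.energy₁ lam k φ * (z ^ (k + 1))⁻¹)
        (ChiralField.lax lam φ z).trace ∧
      HasSum (fun k : ℕ => ChiralField.energy₂ lam k φ * (z ^ (k + 2))⁻¹)
        (ChiralField.lax lam φ z).det) ∧
    -- the functions are real-valued
    (∀ (a : Fin 2 × Fin N) (φ : ChiralField.Phase 2 N),
      (ChiralField.integral lam a φ).im = 0) ∧
    -- the functions are in involution
    (∀ (a b : Fin 2 × Fin N) (φ : ChiralField.Phase 2 N),
      ChiralField.poisson (ChiralField.integral lam a) (ChiralField.integral lam b) φ = 0) ∧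
    -- the functions are functionally independent on a dense open set
    (∃ U : Set (ChiralField.Phase 2 N), IsOpen U ∧ Dense U ∧ ∀ φ ∈ U,
      ChiralField.FunctionallyIndependentAt
        (fun (a : Fin 2 × Fin N) (ψ : ChiralField.Phase 2 N) =>
          (ChiralField.integral lam a ψ).re) φ) := by
  refine ⟨fun φ z h => ?_, fun a φ => Complex.conj_eq_iff_im.1 (ChiralField.star_integral lam a φ),
    ChiralField.poisson_integral lam, ?_⟩
  · have hz : z ≠ 0 := norm_pos_iff.1 ((abs_nonneg _).trans_lt (h ⟨0, hN⟩))
    exact ⟨ChiralField.hasSum_energy₁ lam φ hz h, ChiralField.hasSum_energy₂ lam φ hz h⟩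
  · obtain ⟨n, rfl⟩ := Nat.exists_eq_add_of_le' hN
    choose p q h₁ h₂ using fun α => ChiralField.exists_sq_sub_sq_eq_one (lam α)
    exact ChiralField.exists_dense_functionallyIndependentAt _
      (fun a φ => (Complex.reCLM.analyticAt _).comp (ChiralField.analyticAt_integral lam a φ)) _ _
      (ChiralField.linearIndependent_fderiv_integral hlam h₁ h₂)
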